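/- Let $\mathbb L^4$ be $\mathbb R^4$ with the Lorentzian metric $\langle\,,\rangle=-(dx_0)^2+(dx_1)^2+(dx_2)^2+(dx_3)^2$, and let $\Lambda^+=\{v\in\mathbb L^4:\langle v,v\rangle=0,\ v_0>0\}$ be the future lightcone. Let $\psi:M^2\to\mathbb L^4$ be a spacelike surface, that is, a smooth immersion of a $2$-dimensional manifold whose induced metric (also denoted by $\langle\,,\rangle$) is Riemannian, and suppose that $\psi(M^2)\subset\Lambda^+$. Let $\psi_0>0$ be the first component of $\psi$, let $\nabla\psi_0$ and $\triangle\psi_0$ be its gradient and its Laplacian (the trace of the Hessian) with respect to the induced metric, and let $T$ be the component of $\partial_0=\partial/\partial x_0$ normal to the surface along $\psi$. Let $\mathbf H=\frac12\operatorname{tr}\mathrm{II}$ be the mean curvature vector field of $\psi$, where $\mathrm{II}$ is the second fundamental form, and let $K$ be the Gauss curvature of the induced metric. Then, at every point of $M^2$, $$T=\partial_0\circ\psi+\psi_*(\nabla\psi_0),$$ $$\mathbf H=\left(\frac{\triangle\psi_0}{2\psi_0}-\frac{1+\|\nabla\psi_0\|^2}{\psi_0^2}\right)\psi+\frac1{\psi_0}\,T,$$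 $$K=\frac{1+\|\nabla\psi_0\|^2}{\psi_0^2}-\frac{\triangle\psi_0}{\psi_0},$$ and therefore $$K=\langle\mathbf H,\mathbf H\rangle.$$ -/

import Mathlib

open scoped Manifold ContDiff

noncomputable section

namespace LightconeSurface

/-- The coordinate plane, on which surfaces are modelled. -/
abbrev Plane := EuclideanSpace ℝ (Fin 2)

/-- The vector space underlying Lorentz-Minkowski spacetime `𝕃⁴`, with canonical coordinates
`x₀, x₁, x₂, x₃`; its Lorentzian metric is `mink`. -/
abbrev L4 := Fin 4 → ℝ

/-- The Lorentzian metric `-(dx₀)² + (dx₁)² + (dx₂)² + (dx₃)²`. -/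
def mink (v w : L4) : ℝ := -(v 0 * w 0) + v 1 * w 1 + v 2 * w 2 + v 3 * w 3

/-- The coordinate vector field `∂₀ = ∂/∂x₀`. -/
def timeVec : L4 := Pi.single 0 1

/-- The future lightcone `Λ⁺` at the origin. -/
def futureLightcone : Set L4 := {v | mink v v = 0 ∧ 0 < v 0}

/-- A spacelike surface: a smooth immersion into `𝕃⁴` of a 2-dimensional manifold
whose induced metric tensor is positive definite. -/
structure IsSpacelikeSurface {M : Type*} [TopologicalSpace M] [ChartedSpace Plane M]
    (ψ : M → L4) : Prop where
  smooth : ContMDiff (𝓡 2) 𝓘(ℝ, L4) ∞ ψ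
  immersion : ∀ q : M, Function.Injective (mfderiv (𝓡 2) 𝓘(ℝ, L4) ψ q)
  riemannian : ∀ (q : M) (v : TangentSpace (𝓡 2) q), v ≠ 0 →
    0 < mink (mfderiv (𝓡 2) 𝓘(ℝ, L4) ψ q v) (mfderiv (𝓡 2) 𝓘(ℝ, L4) ψ q v)

/-- The partial derivative `∂ᵢ F` at `x`. -/
def partialDeriv {V : Type*} [NormedAddCommGroup V] [NormedSpace ℝ V]
    (i : Fin 2) (F : Plane → V) (x : Plane) : V :=
  fderiv ℝ F x (EuclideanSpace.single i 1)

/-! ### Intrinsic geometry in coordinates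

Here `g` is the field of matrices `(gᵢⱼ)` of a Riemannian metric in a coordinate system. -/

/-- The Christoffel symbol `Γᵏᵢⱼ` of the Levi-Civita connection:
`∇_{∂ᵢ} ∂ⱼ = ∑ₖ Γᵏᵢⱼ ∂ₖ`. -/
def christoffel (g : Plane → Matrix (Fin 2) (Fin 2) ℝ) (k i j : Fin 2) (x : Plane) : ℝ :=
  (1 / 2) * ∑ l, (g x)⁻¹ k l *
    (partialDeriv i (fun y => g y j l) x + partialDeriv j (fun y => g y i l) x
      - partialDeriv l (fun y => g y i j) x)

/-- The coefficients of the curvature tensor: `R(∂ᵢ, ∂ⱼ) ∂ₖ = ∑ₗ (riemann g l k i j) ∂ₗ`, with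
`R(X, Y) Z = ∇_X ∇_Y Z - ∇_Y ∇_X Z - ∇_[X, Y] Z`. -/
def riemann (g : Plane → Matrix (Fin 2) (Fin 2) ℝ) (l k i j : Fin 2) (x : Plane) : ℝ :=
  partialDeriv i (christoffel g l j k) x - partialDeriv j (christoffel g l i k) x
    + ∑ m, (christoffel g l i m x * christoffel g m j k x
      - christoffel g l j m x * christoffel g m i k x)

/-- The Gauss curvature
`⟨R(∂₀, ∂₁) ∂₁, ∂₀⟩ / (⟨∂₀, ∂₀⟩ ⟨∂₁, ∂₁⟩ - ⟨∂₀, ∂₁⟩²)`. -/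
def gaussCurvature (g : Plane → Matrix (Fin 2) (Fin 2) ℝ) (x : Plane) : ℝ :=
  (∑ l, g x l 0 * riemann g l 1 0 1 x) / (g x 0 0 * g x 1 1 - g x 0 1 ^ 2)

/-- The components `(∇u)ⁱ = ∑ⱼ gⁱʲ ∂ⱼ u` of the gradient. -/
def grad (g : Plane → Matrix (Fin 2) (Fin 2) ℝ) (u : Plane → ℝ) (x : Plane) (i : Fin 2) : ℝ :=
  ∑ j, (g x)⁻¹ i j * partialDeriv j u x

/-- The squared length `‖∇u‖² = g(∇u, ∇u)` of the gradient. -/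
def gradNormSq (g : Plane → Matrix (Fin 2) (Fin 2) ℝ) (u : Plane → ℝ) (x : Plane) : ℝ :=
  ∑ i, ∑ j, g x i j * grad g u x i * grad g u x j

/-- The Hessian `g(∇_{∂ᵢ} ∇u, ∂ⱼ) = ∂ᵢ ∂ⱼ u - ∑ₖ Γᵏᵢⱼ ∂ₖ u`. -/
def hessian (g : Plane → Matrix (Fin 2) (Fin 2) ℝ) (u : Plane → ℝ) (i j : Fin 2)
    (x : Plane) : ℝ :=
  partialDeriv i (partialDeriv j u) x - ∑ k, christoffel g k i j x * partialDeriv k u x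

/-- The Laplacian `Δu`, the trace of the Hessian with respect to the metric. -/
def laplacian (g : Plane → Matrix (Fin 2) (Fin 2) ℝ) (u : Plane → ℝ) (x : Plane) : ℝ :=
  ∑ i, ∑ j, (g x)⁻¹ i j * hessian g u i j x

/-! ### Extrinsic geometry of a parametrized surface `F` in `𝕃⁴` -/

/-- The induced metric `gᵢⱼ = ⟨∂ᵢ F, ∂ⱼ F⟩`. -/
def inducedMetric (F : Plane → L4) (x : Plane) : Matrix (Fin 2) (Fin 2) ℝ :=
  Matrix.of fun i j => mink (partialDeriv i F x) (partialDeriv j F x)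

/-- The tangent vector `F_*(a) = ∑ᵢ aⁱ ∂ᵢ F` with components `aⁱ`. -/
def pushforward (F : Plane → L4) (x : Plane) (a : Fin 2 → ℝ) : L4 :=
  ∑ i, a i • partialDeriv i F x

/-- The second fundamental form, given by the Gauss formula
`II(∂ᵢ, ∂ⱼ) = ∂ᵢ ∂ⱼ F - F_*(∇_{∂ᵢ} ∂ⱼ)`. -/
def secondFundamentalForm (F : Plane → L4) (i j : Fin 2) (x : Plane) : L4 :=
  partialDeriv i (partialDeriv j F) x
    - pushforward F x (fun k => christoffel (inducedMetric F) k i j x)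

/-- The mean curvature vector `H = (1/2) tr II`, the trace taken with respect to the
induced metric. -/
def meanCurvature (F : Plane → L4) (x : Plane) : L4 :=
  (1 / 2 : ℝ) • ∑ i, ∑ j, (inducedMetric F x)⁻¹ i j • secondFundamentalForm F i j x

/-- The component of `v` normal to the surface at `F x`. -/
def normalPart (F : Plane → L4) (x : Plane) (v : L4) : L4 :=
  v - pushforward F x
    (fun i => ∑ j, (inducedMetric F x)⁻¹ i j * mink v (partialDeriv j F x))

/-! ### Surfaces given by a map `ψ` on a manifold, read in a chart `e` -/

section Chart

variable {M : Type*} [TopologicalSpace M]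

/-- The map `ψ` in the chart `e`. -/
def inChart {V : Type*} (ψ : M → V) (e : OpenPartialHomeomorph M Plane) : Plane → V :=
  fun y => ψ (e.symm y)

/-- The mean curvature vector `H` of `ψ` at `q`. -/
def surfaceH (ψ : M → L4) (e : OpenPartialHomeomorph M Plane) (q : M) : L4 :=
  meanCurvature (inChart ψ e) (e q)

/-- The Gauss curvature `K` at `q` of the metric induced by `ψ`. -/
def surfaceK (ψ : M → L4) (e : OpenPartialHomeomorph M Plane) (q : M) : ℝ :=
  gaussCurvature (inducedMetric (inChart ψ e)) (e q)

/-- The Laplacian at `q` of the function `u`, for the metric induced by `ψ`. -/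
def surfaceLaplacian (ψ : M → L4) (u : M → ℝ) (e : OpenPartialHomeomorph M Plane) (q : M) : ℝ :=
  laplacian (inducedMetric (inChart ψ e)) (inChart u e) (e q)

/-- `‖∇u‖²` at `q`, for the metric induced by `ψ`. -/
def surfaceGradNormSq (ψ : M → L4) (u : M → ℝ) (e : OpenPartialHomeomorph M Plane) (q : M) : ℝ :=
  gradNormSq (inducedMetric (inChart ψ e)) (inChart u e) (e q)

/-- The vector `ψ_*(∇u)` at `q`, for the metric induced by `ψ`. -/
def surfaceGradVec (ψ : M → L4) (u : M → ℝ) (e : OpenPartialHomeomorph M Plane) (q : M) : L4 :=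
  pushforward (inChart ψ e) (e q) (grad (inducedMetric (inChart ψ e)) (inChart u e) (e q))

/-- The normal component `T` at `q` of `∂₀` along `ψ`. -/
def surfaceT (ψ : M → L4) (e : OpenPartialHomeomorph M Plane) (q : M) : L4 :=
  normalPart (inChart ψ e) (e q) timeVec

end Chart

end LightconeSurface

end

noncomputable section

namespace LightconeSurface

/-! Read the surface in a chart as a map `F` and write `F₀` for its time coordinate. Differentiating
`⟨F, F⟩ = 0` shows that the position vector `F` is itself normal. With the normal part `T` of `∂₀`
it frames the normal plane, since `⟨F, F⟩ = 0` and `⟨F, T⟩ = -F₀ ≠ 0`; moreover `⟨T, T⟩ = -(1 +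
‖∇F₀‖²)`. A normal vector `w` is thus determined by two numbers, `⟨w, F⟩` and `w₀ = -⟨w, ∂₀⟩ = -⟨w,
T⟩` (`eq_of_normal`).

For `II` both numbers are known: `⟨II, F⟩ = -g`, and the time component of `II` is the Hessian of
`F₀`. Taking half the trace gives `⟨H, F⟩ = -1` and `H₀ = ΔF₀ / 2`, hence the formula for `H`. The
same data inserted in the Gauss equation (`gauss_equation`) give `K`, and computing `⟨H, H⟩` in the
frame gives the same value. -/

/-! ### Algebra of the Lorentzian form -/

theorem mink_comm (v w : L4) : mink v w = mink w v := by
  simp only [mink]; ring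

theorem mink_add_left (u v w : L4) : mink (u + v) w = mink u w + mink v w := by
  simp only [mink, Pi.add_apply]; ring

theorem mink_add_right (u v w : L4) : mink u (v + w) = mink u v + mink u w := by
  simp only [mink, Pi.add_apply]; ring

theorem mink_sub_left (u v w : L4) : mink (u - v) w = mink u w - mink v w := by
  simp only [mink, Pi.sub_apply]; ring

theorem mink_sub_right (u v w : L4) : mink u (v - w) = mink u v - mink u w := by
  simp only [mink, Pi.sub_apply]; ring

theorem mink_smul_left (c : ℝ) (v w : L4) : mink (c • v) w = c * mink v w := by
  simp only [mink, Pi.smul_apply, smul_eq_mul]; ring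

theorem mink_smul_right (c : ℝ) (v w : L4) : mink v (c • w) = c * mink v w := by
  simp only [mink, Pi.smul_apply, smul_eq_mul]; ring

theorem mink_timeVec_left (v : L4) : mink timeVec v = -v 0 := by
  simp [mink, timeVec]

/-- A vector orthogonal to four vectors with nondegenerate Gram matrix vanishes. -/
theorem eq_zero_of_mink_eq_zero {v : Fin 4 → L4}
    (hdet : (Matrix.of fun i j => mink (v i) (v j)).det ≠ 0) {w : L4}
    (hw : ∀ i, mink (v i) w = 0) : w = 0 := by
  -- The Gram matrix factors as `V η Vᵀ`, so its nondegeneracy makes `V` invertible.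
  set η : Matrix (Fin 4) (Fin 4) ℝ := Matrix.diagonal ![-1, 1, 1, 1] with hη
  have hmink (a b : L4) : mink a b = a ⬝ᵥ (η.mulVec b) := by
    simp [mink, hη, Matrix.mulVec_diagonal, dotProduct, Fin.sum_univ_four]
  have hgram : (Matrix.of fun i j => mink (v i) (v j)) =
      Matrix.of v * (η * (Matrix.of v).transpose) := by
    ext i j
    rw [Matrix.of_apply, hmink]
    rfl
  have hA : (Matrix.of v).det ≠ 0 := by
    intro h
    rw [hgram, Matrix.det_mul, h, zero_mul] at hdet
    exact hdet rfl
  have h0 : η.mulVec w = 0 := by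
    refine Matrix.eq_zero_of_mulVec_eq_zero hA ?_
    ext i
    rw [Pi.zero_apply, ← hw i, hmink]
    rfl
  ext i
  have hi := congrFun h0 i
  fin_cases i <;> simpa [hη, Matrix.mulVec_diagonal] using hi

/-! ### Calculus of partial derivatives -/

section Calculus

variable {V : Type*} [NormedAddCommGroup V] [NormedSpace ℝ V]

theorem partialDeriv_congr {F G : Plane → V} {x : Plane} (h : F =ᶠ[nhds x] G) (i : Fin 2) :
    partialDeriv i F x = partialDeriv i G x := by
  rw [partialDeriv, partialDeriv, h.fderiv_eq]

theorem contDiffAt_partialDeriv {F : Plane → V} {x : Plane} (h : ContDiffAt ℝ ∞ F x)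
    (i : Fin 2) : ContDiffAt ℝ ∞ (partialDeriv i F) x :=
  (h.fderiv_right (m := ∞) (by simp)).clm_apply contDiffAt_const

theorem partialDeriv_comm {F : Plane → V} {x : Plane} (h : ContDiffAt ℝ ∞ F x) (i j : Fin 2) :
    partialDeriv i (partialDeriv j F) x = partialDeriv j (partialDeriv i F) x := by
  have hd : DifferentiableAt ℝ (fderiv ℝ F) x :=
    (h.fderiv_right (m := ∞) (by simp)).differentiableAt (by simp)
  have key (a b : Fin 2) : partialDeriv a (partialDeriv b F) x =
      fderiv ℝ (fderiv ℝ F) x (EuclideanSpace.single a 1) (EuclideanSpace.single b 1) := by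
    unfold partialDeriv
    rw [fderiv_clm_apply hd (differentiableAt_const _)]
    simp
  rw [key, key]
  exact (h.isSymmSndFDerivAt (by simpa using ENat.LEInfty.out)) _ _

theorem partialDeriv_apply {F : Plane → L4} {x : Plane} (h : DifferentiableAt ℝ F x)
    (i : Fin 2) (c : Fin 4) : partialDeriv i F x c = partialDeriv i (fun y => F y c) x := by
  unfold partialDeriv
  rw [fderiv_apply h]
  rfl

theorem partialDeriv_mul {f h : Plane → ℝ} {x : Plane} (hf : DifferentiableAt ℝ f x)
    (hh : DifferentiableAt ℝ h x) (i : Fin 2) :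
    partialDeriv i (fun y => f y * h y) x =
      partialDeriv i f x * h x + f x * partialDeriv i h x := by
  unfold partialDeriv
  rw [fderiv_fun_mul hf hh]
  simp
  ring

theorem partialDeriv_add {f h : Plane → ℝ} {x : Plane} (hf : DifferentiableAt ℝ f x)
    (hh : DifferentiableAt ℝ h x) (i : Fin 2) :
    partialDeriv i (fun y => f y + h y) x = partialDeriv i f x + partialDeriv i h x := by
  unfold partialDeriv
  rw [fderiv_fun_add hf hh]
  rfl

theorem partialDeriv_mink {A B : Plane → L4} {x : Plane} (hA : DifferentiableAt ℝ A x)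
    (hB : DifferentiableAt ℝ B x) (i : Fin 2) :
    partialDeriv i (fun y => mink (A y) (B y)) x =
      mink (partialDeriv i A x) (B x) + mink (A x) (partialDeriv i B x) := by
  have hA' := differentiableAt_pi.1 hA
  have hB' := differentiableAt_pi.1 hB
  have hm (c : Fin 4) := (hA' c).fun_mul (hB' c)
  have hneg : partialDeriv i (fun y => -(A y 0 * B y 0)) x =
      -partialDeriv i (fun y => A y 0 * B y 0) x := by
    unfold partialDeriv
    rw [fderiv_fun_neg]
    rfl
  simp only [mink]
  rw [partialDeriv_add (((hm 0).fun_neg.fun_add (hm 1)).fun_add (hm 2)) (hm 3),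
    partialDeriv_add ((hm 0).fun_neg.fun_add (hm 1)) (hm 2),
    partialDeriv_add (hm 0).fun_neg (hm 1), hneg]
  simp only [partialDeriv_mul (hA' _) (hB' _), partialDeriv_apply hA, partialDeriv_apply hB]
  ring

theorem contDiffAt_mink {A B : Plane → L4} {x : Plane} (hA : ContDiffAt ℝ ∞ A x)
    (hB : ContDiffAt ℝ ∞ B x) : ContDiffAt ℝ ∞ (fun y => mink (A y) (B y)) x := by
  have hA' := contDiffAt_pi.1 hA
  have hB' := contDiffAt_pi.1 hB
  exact ((((hA' 0).mul (hB' 0)).neg.add ((hA' 1).mul (hB' 1))).add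
    ((hA' 2).mul (hB' 2))).add ((hA' 3).mul (hB' 3))

end Calculus

/-! ### Christoffel symbols -/

theorem inv_apply_fin_two (A : Matrix (Fin 2) (Fin 2) ℝ) (i j : Fin 2) :
    A⁻¹ i j = A.det⁻¹ * A.adjugate i j := by
  simp [Matrix.inv_def, Ring.inverse_eq_inv']

theorem contDiffAt_christoffel {g : Plane → Matrix (Fin 2) (Fin 2) ℝ} {x : Plane}
    (hg : ∀ i j, ContDiffAt ℝ ∞ (fun y => g y i j) x) (hdet : (g x).det ≠ 0) (k i j : Fin 2) :
    ContDiffAt ℝ ∞ (christoffel g k i j) x := by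
  have hd : ContDiffAt ℝ ∞ (fun y => (g y).det) x := by
    simp only [Matrix.det_fin_two]
    exact ((hg 0 0).mul (hg 1 1)).sub ((hg 0 1).mul (hg 1 0))
  have hinv (a b : Fin 2) : ContDiffAt ℝ ∞ (fun y => (g y)⁻¹ a b) x := by
    simp only [inv_apply_fin_two]
    refine (hd.inv hdet).mul ?_
    simp only [Matrix.adjugate_fin_two]
    fin_cases a <;> fin_cases b
    · simpa using hg 1 1
    · simpa using (hg 0 1).neg
    · simpa using (hg 1 0).neg
    · simpa using hg 0 0
  have hp (a b c : Fin 2) := contDiffAt_partialDeriv (hg b c) a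
  exact contDiffAt_const.mul (ContDiffAt.sum fun l _ =>
    (hinv k l).mul (((hp i j l).add (hp j i l)).sub (hp l i j)))

/-- The Christoffel symbols with lowered index. -/
theorem sum_mul_christoffel {g : Plane → Matrix (Fin 2) (Fin 2) ℝ} {x : Plane}
    (hdet : (g x).det ≠ 0) (l i j : Fin 2) :
    ∑ k, g x l k * christoffel g k i j x =
      (1 / 2) * (partialDeriv i (fun y => g y j l) x + partialDeriv j (fun y => g y i l) x
        - partialDeriv l (fun y => g y i j) x) := by
  set c : Fin 2 → ℝ := fun m => partialDeriv i (fun y => g y j m) x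
    + partialDeriv j (fun y => g y i m) x - partialDeriv m (fun y => g y i j) x
  have h : ((g x).mulVec ((g x)⁻¹.mulVec c)) l = c l := by
    rw [Matrix.mulVec_mulVec, Matrix.mul_nonsing_inv _ (isUnit_iff_ne_zero.2 hdet),
      Matrix.one_mulVec]
  change _ = (1 / 2) * c l
  rw [← h]
  simp only [Matrix.mulVec, dotProduct, christoffel, Fin.sum_univ_two, c]
  ring

/-! ### The Gauss formula and the Gauss equation -/

theorem inducedMetric_comm (F : Plane → L4) (x : Plane) (i j : Fin 2) :
    inducedMetric F x i j = inducedMetric F x j i :=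
  mink_comm _ _

theorem contDiffAt_inducedMetric {F : Plane → L4} {x : Plane} (h : ContDiffAt ℝ ∞ F x)
    (i j : Fin 2) : ContDiffAt ℝ ∞ (fun y => inducedMetric F y i j) x :=
  contDiffAt_mink (contDiffAt_partialDeriv h i) (contDiffAt_partialDeriv h j)

theorem partialDeriv_inducedMetric {F : Plane → L4} {x : Plane} (h : ContDiffAt ℝ ∞ F x)
    (i j k : Fin 2) : partialDeriv i (fun y => inducedMetric F y j k) x =
      mink (partialDeriv i (partialDeriv j F) x) (partialDeriv k F x)
        + mink (partialDeriv j F x) (partialDeriv i (partialDeriv k F) x) :=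
  partialDeriv_mink ((contDiffAt_partialDeriv h j).differentiableAt (by simp))
    ((contDiffAt_partialDeriv h k).differentiableAt (by simp)) i

/-- Expanding the derivatives of `g` by the product rule, the symmetry of second derivatives of `F`
cancels all terms but two equal ones. -/
theorem sum_inducedMetric_mul_christoffel {F : Plane → L4} {x : Plane} (h : ContDiffAt ℝ ∞ F x)
    (hdet : (inducedMetric F x).det ≠ 0) (l i j : Fin 2) :
    ∑ k, inducedMetric F x l k * christoffel (inducedMetric F) k i j x =
      mink (partialDeriv i (partialDeriv j F) x) (partialDeriv l F x) := by
  rw [sum_mul_christoffel hdet]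
  simp only [partialDeriv_inducedMetric h]
  rw [partialDeriv_comm h j i, partialDeriv_comm h l i, partialDeriv_comm h l j,
    mink_comm (partialDeriv j F x), mink_comm (partialDeriv i F x)]
  ring

theorem mink_pushforward (F : Plane → L4) (x : Plane) (a : Fin 2 → ℝ) (v : L4) :
    mink (pushforward F x a) v = ∑ i, a i * mink (partialDeriv i F x) v := by
  simp only [pushforward, Fin.sum_univ_two, mink_add_left, mink_smul_left]

theorem mink_secondFundamentalForm_partialDeriv {F : Plane → L4} {x : Plane}
    (h : ContDiffAt ℝ ∞ F x) (hdet : (inducedMetric F x).det ≠ 0) (i j l : Fin 2) :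
    mink (secondFundamentalForm F i j x) (partialDeriv l F x) = 0 := by
  rw [secondFundamentalForm, mink_sub_left, mink_pushforward,
    ← sum_inducedMetric_mul_christoffel h hdet, sub_eq_zero]
  refine Finset.sum_congr rfl fun k _ => ?_
  rw [inducedMetric_comm, mul_comm]
  rfl

/-- The derivative of the Gauss formula paired with a coordinate vector. -/
theorem sum_inducedMetric_mul_partialDeriv_christoffel {F : Plane → L4} {x : Plane}
    (h : ∀ᶠ y in nhds x, ContDiffAt ℝ ∞ F y)
    (hdet : ∀ᶠ y in nhds x, (inducedMetric F y).det ≠ 0) (i j k l : Fin 2) :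
    mink (partialDeriv i (partialDeriv j (partialDeriv k F)) x) (partialDeriv l F x)
      + mink (partialDeriv j (partialDeriv k F) x) (partialDeriv i (partialDeriv l F) x) =
    ∑ m, ((mink (partialDeriv i (partialDeriv l F) x) (partialDeriv m F x)
        + mink (partialDeriv i (partialDeriv m F) x) (partialDeriv l F x))
          * christoffel (inducedMetric F) m j k x
      + inducedMetric F x l m * partialDeriv i (christoffel (inducedMetric F) m j k) x) := by
  have hx := h.self_of_nhds
  have hΓ (m : Fin 2) := (contDiffAt_christoffel (contDiffAt_inducedMetric hx)
    hdet.self_of_nhds m j k).differentiableAt (n := ∞) (by simp)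
  have hg (m : Fin 2) := (contDiffAt_inducedMetric hx l m).differentiableAt (by simp)
  -- The lowered Christoffel identity holds on a neighbourhood, so it may be differentiated at `x`.
  have heq : (fun y => mink (partialDeriv j (partialDeriv k F) y) (partialDeriv l F y))
      =ᶠ[nhds x] fun y => inducedMetric F y l 0 * christoffel (inducedMetric F) 0 j k y
        + inducedMetric F y l 1 * christoffel (inducedMetric F) 1 j k y := by
    filter_upwards [h, hdet] with y hy hy'
    rw [← sum_inducedMetric_mul_christoffel hy hy', Fin.sum_univ_two]
  have hk := contDiffAt_partialDeriv hx k
  rw [← partialDeriv_mink ((contDiffAt_partialDeriv hk j).differentiableAt (by simp))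
    ((contDiffAt_partialDeriv hx l).differentiableAt (by simp)), partialDeriv_congr heq,
    partialDeriv_add ((hg 0).fun_mul (hΓ 0)) ((hg 1).fun_mul (hΓ 1)),
    partialDeriv_mul (hg 0) (hΓ 0), partialDeriv_mul (hg 1) (hΓ 1), Fin.sum_univ_two]
  simp only [partialDeriv_inducedMetric hx, mink_comm (partialDeriv l F x)]

/-- The Gauss equation. -/
theorem gauss_equation {F : Plane → L4} {x : Plane}
    (h : ∀ᶠ y in nhds x, ContDiffAt ℝ ∞ F y)
    (hdet : ∀ᶠ y in nhds x, (inducedMetric F y).det ≠ 0) :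
    ∑ l, inducedMetric F x l 0 * riemann (inducedMetric F) l 1 0 1 x =
      mink (secondFundamentalForm F 0 0 x) (secondFundamentalForm F 1 1 x)
        - mink (secondFundamentalForm F 0 1 x) (secondFundamentalForm F 0 1 x) := by
  have hx := h.self_of_nhds
  have hdx := hdet.self_of_nhds
  have e1 := sum_inducedMetric_mul_partialDeriv_christoffel h hdet 0 1 1 0
  have e2 := sum_inducedMetric_mul_partialDeriv_christoffel h hdet 1 0 1 0
  rw [partialDeriv_comm (contDiffAt_partialDeriv hx 1) 1 0] at e2
  have hII (i j k l : Fin 2) :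
      mink (secondFundamentalForm F i j x) (secondFundamentalForm F k l x) =
        mink (partialDeriv i (partialDeriv j F) x) (partialDeriv k (partialDeriv l F) x)
        - ∑ m, christoffel (inducedMetric F) m i j x
          * mink (partialDeriv k (partialDeriv l F) x) (partialDeriv m F x) := by
    rw [secondFundamentalForm.eq_def F k l, mink_sub_right, mink_comm _ (pushforward F x _),
      mink_pushforward]
    simp only [mink_comm (partialDeriv _ F x),
      mink_secondFundamentalForm_partialDeriv hx hdx i j, mul_zero, Finset.sum_const_zero,
      sub_zero]
    rw [secondFundamentalForm, mink_sub_left, mink_pushforward]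
    simp only [mink_comm (partialDeriv _ F x)]
  have c (i m : Fin 2) := sum_inducedMetric_mul_christoffel hx hdx 0 i m
  have c00 := c 0 0
  have c01 := c 0 1
  have c10 := c 1 0
  have c11 := c 1 1
  rw [mink_comm (secondFundamentalForm F 0 0 x), hII, hII]
  simp only [riemann, Fin.sum_univ_two, inducedMetric_comm F x 1 0,
    partialDeriv_comm hx 1 0] at *
  set Γ := christoffel (inducedMetric F)
  -- The third derivatives of `F` cancel in `e2 - e1`; the remaining terms turn the lowered products
  -- `ΓΓ` into pairings with second derivatives of `F`.
  linear_combination e2 - e1 + Γ 0 1 1 x * c00 + Γ 1 1 1 x * c01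
    - Γ 0 0 1 x * c10 - Γ 1 0 1 x * c11

/-! ### Surfaces in the lightcone -/

section Lightcone

variable {F : Plane → L4} {x : Plane}

theorem sum_inv_mul_inducedMetric (hdet : (inducedMetric F x).det ≠ 0) (a : Fin 2 → ℝ)
    (l : Fin 2) :
    ∑ i, (∑ j, (inducedMetric F x)⁻¹ i j * a j) * inducedMetric F x i l = a l := by
  have h : ((inducedMetric F x).mulVec ((inducedMetric F x)⁻¹.mulVec a)) l = a l := by
    rw [Matrix.mulVec_mulVec, Matrix.mul_nonsing_inv _ (isUnit_iff_ne_zero.2 hdet),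
      Matrix.one_mulVec]
  conv_rhs => rw [← h]
  simp only [Matrix.mulVec, dotProduct, inducedMetric_comm F x _ l, mul_comm]

theorem mink_normalPart_partialDeriv (hdet : (inducedMetric F x).det ≠ 0) (v : L4)
    (l : Fin 2) : mink (normalPart F x v) (partialDeriv l F x) = 0 := by
  rw [normalPart, mink_sub_left, mink_pushforward, sub_eq_zero]
  exact (sum_inv_mul_inducedMetric hdet (fun j => mink v (partialDeriv j F x)) l).symm

/-- The normal component of `∂₀` is `∂₀ + F_*(∇F₀)`. -/
theorem normalPart_timeVec (h : DifferentiableAt ℝ F x) :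
    normalPart F x timeVec =
      timeVec + pushforward F x (grad (inducedMetric F) (fun y => F y 0) x) := by
  have : (fun i => ∑ j, (inducedMetric F x)⁻¹ i j * mink timeVec (partialDeriv j F x)) =
      fun i => -grad (inducedMetric F) (fun y => F y 0) x i := by
    ext i
    simp only [grad, mink_timeVec_left, partialDeriv_apply h, mul_neg, Finset.sum_neg_distrib]
  rw [normalPart, this]
  simp only [pushforward, neg_smul, Finset.sum_neg_distrib, sub_neg_eq_add]

theorem mink_normalPart_of_normal (v : L4) {w : L4}
    (hw : ∀ l, mink w (partialDeriv l F x) = 0) : mink (normalPart F x v) w = mink v w := by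
  rw [normalPart, mink_sub_left, mink_pushforward]
  simp only [mink_comm _ w, hw, mul_zero, Finset.sum_const_zero, sub_zero]

/-- As `T` is normal, `⟨T, T⟩ = ⟨∂₀, T⟩ = -T₀`, and `T₀` is read off from `T = ∂₀ + F_*(∇F₀)`. -/
theorem mink_normalPart_timeVec_self (h : DifferentiableAt ℝ F x)
    (hdet : (inducedMetric F x).det ≠ 0) :
    mink (normalPart F x timeVec) (normalPart F x timeVec) =
      -(1 + gradNormSq (inducedMetric F) (fun y => F y 0) x) := by
  rw [mink_normalPart_of_normal _ (mink_normalPart_partialDeriv hdet timeVec),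
    normalPart_timeVec h, mink_timeVec_left]
  have hg := sum_inv_mul_inducedMetric hdet (fun j => partialDeriv j (fun y => F y 0) x)
  set u := grad (inducedMetric F) (fun y => F y 0) x with hu
  have hg' (l : Fin 2) : u 0 * inducedMetric F x 0 l + u 1 * inducedMetric F x 1 l =
      partialDeriv l F x 0 := by
    rw [partialDeriv_apply h, ← hg l, Fin.sum_univ_two]
    rfl
  simp only [gradNormSq, ← hu, Fin.sum_univ_two, pushforward, timeVec, Pi.add_apply,
    Pi.single_eq_same, Pi.smul_apply, smul_eq_mul]
  linear_combination u 0 * hg' 0 + u 1 * hg' 1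

theorem mink_partialDeriv_self_of_null (h : ContDiffAt ℝ ∞ F x)
    (hnull : ∀ᶠ y in nhds x, mink (F y) (F y) = 0) (i : Fin 2) :
    mink (F x) (partialDeriv i F x) = 0 := by
  have hd := h.differentiableAt (by simp)
  have e : partialDeriv i (fun y => mink (F y) (F y)) x = 0 := by
    rw [partialDeriv_congr (G := fun _ => (0 : ℝ)) hnull]
    simp [partialDeriv]
  rw [partialDeriv_mink hd hd, mink_comm (partialDeriv i F x)] at e
  linarith

/-- Differentiate `⟨F, ∂ⱼF⟩ = 0`; the tangential correction in `II` pairs to zero with the normal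
vector `F`. -/
theorem mink_secondFundamentalForm_self_of_null (h : ∀ᶠ y in nhds x, ContDiffAt ℝ ∞ F y)
    (hnull : ∀ᶠ y in nhds x, mink (F y) (F y) = 0) (i j : Fin 2) :
    mink (secondFundamentalForm F i j x) (F x) = -inducedMetric F x i j := by
  have hx := h.self_of_nhds
  have hz : (fun y => mink (F y) (partialDeriv j F y)) =ᶠ[nhds x] fun _ => 0 := by
    filter_upwards [h, hnull.eventually_nhds] with y hy hy'
    exact mink_partialDeriv_self_of_null hy hy' j
  have e := partialDeriv_congr hz i
  rw [partialDeriv_mink (hx.differentiableAt (by simp))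
    ((contDiffAt_partialDeriv hx j).differentiableAt (by simp))] at e
  have e' : partialDeriv i (fun _ : Plane => (0 : ℝ)) x = 0 := by simp [partialDeriv]
  rw [secondFundamentalForm, mink_sub_left, mink_pushforward]
  simp only [mink_comm _ (F x), mink_partialDeriv_self_of_null hx hnull, mul_zero,
    Finset.sum_const_zero, sub_zero]
  change _ = -mink (partialDeriv i F x) (partialDeriv j F x)
  linarith

/-- The Gauss formula, read componentwise, is the definition of the Hessian of a coordinate
function. -/
theorem secondFundamentalForm_apply (h : ∀ᶠ y in nhds x, ContDiffAt ℝ ∞ F y)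
    (i j : Fin 2) (c : Fin 4) :
    secondFundamentalForm F i j x c = hessian (inducedMetric F) (fun y => F y c) i j x := by
  have hx := h.self_of_nhds
  have hd {G : Plane → L4} {y : Plane} (hy : ContDiffAt ℝ ∞ G y) : DifferentiableAt ℝ G y :=
    hy.differentiableAt (by simp)
  have he : (fun y => partialDeriv j F y c) =ᶠ[nhds x] partialDeriv j fun y => F y c := by
    filter_upwards [h] with y hy
    exact partialDeriv_apply (hd hy) j c
  rw [hessian, ← partialDeriv_congr he,
    ← partialDeriv_apply (hd (contDiffAt_partialDeriv hx j))]
  simp [secondFundamentalForm, pushforward, Fin.sum_univ_two, partialDeriv_apply (hd hx)]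

/-- A normal vector of a surface in the lightcone, in terms of the normal frame
`F`, `T`. -/
theorem eq_of_normal (h : ContDiffAt ℝ ∞ F x) (hdet : (inducedMetric F x).det ≠ 0)
    (hnull : ∀ᶠ y in nhds x, mink (F y) (F y) = 0) (hpos : 0 < F x 0) {w : L4}
    (hw : ∀ l, mink w (partialDeriv l F x) = 0) :
    w = (w 0 / F x 0 + mink w (F x)
          * ((1 + gradNormSq (inducedMetric F) (fun y => F y 0) x) / F x 0 ^ 2)) • F x
      + (-mink w (F x) / F x 0) • normalPart F x timeVec := by
  have hFn := mink_partialDeriv_self_of_null h hnull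
  have hTn := mink_normalPart_partialDeriv hdet timeVec
  have hTT := mink_normalPart_timeVec_self (h.differentiableAt (by simp)) hdet
  have hTF := mink_normalPart_of_normal timeVec hFn
  have hTw := mink_normalPart_of_normal timeVec hw
  rw [mink_timeVec_left] at hTF hTw
  have hFF := hnull.self_of_nhds
  set T := normalPart F x timeVec
  set N := gradNormSq (inducedMetric F) (fun y => F y 0) x
  rw [← sub_eq_zero]
  refine eq_zero_of_mink_eq_zero (v := ![partialDeriv 0 F x, partialDeriv 1 F x, F x, T]) ?_ ?_
  · have hg (i j : Fin 2) : mink (partialDeriv i F x) (partialDeriv j F x) =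
      inducedMetric F x i j := rfl
    have hFT : mink (F x) T = -F x 0 := by rw [mink_comm, hTF]
    rw [Matrix.det_fin_two] at hdet
    -- The Gram matrix is block diagonal: the tangent block is `g`, and the `F`, `T` block has
    -- determinant `-F₀²` whatever `⟨T, T⟩` is.
    have : (Matrix.of fun i j => mink (![partialDeriv 0 F x, partialDeriv 1 F x, F x, T] i)
        (![partialDeriv 0 F x, partialDeriv 1 F x, F x, T] j)).det =
        -F x 0 ^ 2 * (inducedMetric F x 0 0 * inducedMetric F x 1 1
          - inducedMetric F x 0 1 * inducedMetric F x 1 0) := by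
      simp [Matrix.det_succ_row_zero, Fin.sum_univ_succ, Fin.succAbove, hg, hFn, hTn, hFF,
        hTF, hFT, mink_comm (partialDeriv _ F x) (F x), mink_comm (partialDeriv _ F x) T]
      ring
    rw [this]
    exact mul_ne_zero (by simp [hpos.ne']) hdet
  · have hF (v : L4) : mink v (w - ((w 0 / F x 0 + mink w (F x) * ((1 + N) / F x 0 ^ 2)) • F x
      + (-mink w (F x) / F x 0) • T)) = mink v w - ((w 0 / F x 0
        + mink w (F x) * ((1 + N) / F x 0 ^ 2)) * mink v (F x)
        + (-mink w (F x) / F x 0) * mink v T) := by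
      simp only [mink_sub_right, mink_add_right, mink_smul_right]
    intro i
    rw [hF]
    fin_cases i
    · simp [mink_comm (partialDeriv _ F x), hw, hFn, hTn]
    · simp [mink_comm (partialDeriv _ F x), hw, hFn, hTn]
    · simp only [Fin.reduceFinMk, Matrix.cons_val]
      rw [hFF, mink_comm _ T, hTF, mink_comm (F x) w]
      field_simp
      ring
    · simp only [Fin.reduceFinMk, Matrix.cons_val]
      rw [hTw, hTF, hTT]
      field_simp
      ring

theorem mink_meanCurvature (v : L4) :
    mink (meanCurvature F x) v = (1 / 2) * ∑ i, ∑ j, (inducedMetric F x)⁻¹ i j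
      * mink (secondFundamentalForm F i j x) v := by
  simp only [meanCurvature, Fin.sum_univ_two, mink_add_left, mink_smul_left]

theorem meanCurvature_eq_of_null (h : ∀ᶠ y in nhds x, ContDiffAt ℝ ∞ F y)
    (hdet : (inducedMetric F x).det ≠ 0)
    (hnull : ∀ᶠ y in nhds x, mink (F y) (F y) = 0) (hpos : 0 < F x 0) :
    meanCurvature F x =
      (laplacian (inducedMetric F) (fun y => F y 0) x / (2 * F x 0)
        - (1 + gradNormSq (inducedMetric F) (fun y => F y 0) x) / F x 0 ^ 2) • F x
      + (1 / F x 0) • normalPart F x timeVec := by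
  have hx := h.self_of_nhds
  have hn (l : Fin 2) : mink (meanCurvature F x) (partialDeriv l F x) = 0 := by
    simp [mink_meanCurvature,
      mink_secondFundamentalForm_partialDeriv hx hdet]
  have hF : mink (meanCurvature F x) (F x) = -1 := by
    rw [mink_meanCurvature]
    simp only [mink_secondFundamentalForm_self_of_null h hnull]
    have hI := Matrix.nonsing_inv_mul _ (isUnit_iff_ne_zero.2 hdet)
    have h0 := congrFun (congrFun hI 0) 0
    have h1 := congrFun (congrFun hI 1) 1
    simp only [Matrix.mul_apply, Fin.sum_univ_two, Matrix.one_apply_eq] at h0 h1 ⊢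
    rw [inducedMetric_comm F x 1 0] at h0 ⊢
    -- Here `⟨H, F⟩ = -(1/2) tr (g⁻¹ g)`, and the trace is the dimension `2`.
    linear_combination (-1 / 2) * h0 + (-1 / 2) * h1
  have h0 : meanCurvature F x 0 = laplacian (inducedMetric F) (fun y => F y 0) x / 2 := by
    simp only [meanCurvature, laplacian, Pi.smul_apply, Finset.sum_apply, smul_eq_mul,
      secondFundamentalForm_apply h]
    ring
  have key := eq_of_normal hx hdet hnull hpos hn
  rw [hF, h0] at key
  convert key using 3
  · field_simp
    ring
  · rw [neg_neg]

theorem mink_eq_of_normal (h : ContDiffAt ℝ ∞ F x)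
    (hdet : (inducedMetric F x).det ≠ 0)
    (hnull : ∀ᶠ y in nhds x, mink (F y) (F y) = 0) (hpos : 0 < F x 0) {v w : L4}
    (hv : ∀ l, mink v (partialDeriv l F x) = 0) (hw : ∀ l, mink w (partialDeriv l F x) = 0) :
    mink v w = (v 0 * mink w (F x) + w 0 * mink v (F x)) / F x 0
      + mink v (F x) * mink w (F x)
        * ((1 + gradNormSq (inducedMetric F) (fun y => F y 0) x) / F x 0 ^ 2) := by
  have hTw := mink_normalPart_of_normal timeVec hw
  rw [mink_timeVec_left] at hTw
  conv_lhs => rw [eq_of_normal h hdet hnull hpos hv]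
  rw [mink_add_left, mink_smul_left, mink_smul_left, hTw, mink_comm (F x)]
  ring

/-- In the Gauss equation the terms quadratic in `g` give `det g` times `(1 + ‖∇F₀‖²) / F₀²`, and
the terms mixing `g` with the Hessian give `det g` times `-ΔF₀ / F₀`. -/
theorem gaussCurvature_eq_of_null (h : ∀ᶠ y in nhds x, ContDiffAt ℝ ∞ F y)
    (hdet : ∀ᶠ y in nhds x, (inducedMetric F y).det ≠ 0)
    (hnull : ∀ᶠ y in nhds x, mink (F y) (F y) = 0) (hpos : 0 < F x 0) :
    gaussCurvature (inducedMetric F) x =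
      (1 + gradNormSq (inducedMetric F) (fun y => F y 0) x) / F x 0 ^ 2
        - laplacian (inducedMetric F) (fun y => F y 0) x / F x 0 := by
  have hx := h.self_of_nhds
  have hdx := hdet.self_of_nhds
  have hn := mink_secondFundamentalForm_partialDeriv hx hdx
  have hsymm : hessian (inducedMetric F) (fun y => F y 0) 1 0 x =
      hessian (inducedMetric F) (fun y => F y 0) 0 1 x := by
    have hc (k : Fin 2) : christoffel (inducedMetric F) k 1 0 x =
        christoffel (inducedMetric F) k 0 1 x := by
      simp only [christoffel, Fin.sum_univ_two, inducedMetric_comm F _ 1 0]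
      ring
    simp only [hessian, hc]
    rw [partialDeriv_comm (contDiffAt_pi.1 hx 0)]
  rw [gaussCurvature, gauss_equation h hdet,
    mink_eq_of_normal hx hdx hnull hpos (hn 0 0) (hn 1 1),
    mink_eq_of_normal hx hdx hnull hpos (hn 0 1) (hn 0 1)]
  simp only [mink_secondFundamentalForm_self_of_null h hnull, secondFundamentalForm_apply h,
    laplacian, Fin.sum_univ_two, inv_apply_fin_two, Matrix.adjugate_fin_two, hsymm]
  rw [Matrix.det_fin_two, inducedMetric_comm F x 1 0, ← sq] at hdx
  simp only [Matrix.det_fin_two, Matrix.of_apply, Matrix.cons_val, inducedMetric_comm F x 1 0,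
    ← sq]
  generalize inducedMetric F x 0 0 = a at hdx ⊢
  generalize inducedMetric F x 0 1 = b at hdx ⊢
  generalize inducedMetric F x 1 1 = c at hdx ⊢
  generalize hD : a * c - b ^ 2 = D at hdx ⊢
  field_simp
  linear_combination (1 + gradNormSq (inducedMetric F) (fun y => F y 0) x) * hD

theorem gaussCurvature_eq_mink_meanCurvature (h : ∀ᶠ y in nhds x, ContDiffAt ℝ ∞ F y)
    (hdet : ∀ᶠ y in nhds x, (inducedMetric F y).det ≠ 0)
    (hnull : ∀ᶠ y in nhds x, mink (F y) (F y) = 0) (hpos : 0 < F x 0) :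
    gaussCurvature (inducedMetric F) x = mink (meanCurvature F x) (meanCurvature F x) := by
  have hx := h.self_of_nhds
  have hdx := hdet.self_of_nhds
  rw [gaussCurvature_eq_of_null h hdet hnull hpos,
    meanCurvature_eq_of_null h hdx hnull hpos]
  have hTF := mink_normalPart_of_normal timeVec (mink_partialDeriv_self_of_null hx hnull)
  have hTT := mink_normalPart_timeVec_self (hx.differentiableAt (by simp)) hdx
  rw [mink_timeVec_left] at hTF
  simp only [mink_add_left, mink_add_right, mink_smul_left, mink_smul_right,
    hnull.self_of_nhds, mink_comm (F x) (normalPart F x timeVec), hTF, hTT]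
  field_simp
  ring

end Lightcone

/-! ### Reading a surface in a chart -/

theorem det_inducedMetric_pos {F : Plane → L4} {x : Plane}
    (h : ∀ v, v ≠ 0 → 0 < mink (fderiv ℝ F x v) (fderiv ℝ F x v)) :
    0 < (inducedMetric F x).det := by
  set A := inducedMetric F x with hA
  have hq (a b : ℝ) (hab : a ≠ 0 ∨ b ≠ 0) :
      0 < a * a * A 0 0 + 2 * a * b * A 0 1 + b * b * A 1 1 := by
    have hne : a • EuclideanSpace.single (0 : Fin 2) (1 : ℝ)
        + b • EuclideanSpace.single (1 : Fin 2) (1 : ℝ) ≠ 0 := by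
      intro h0
      have e0 := congrFun (congrArg WithLp.ofLp h0) 0
      have e1 := congrFun (congrArg WithLp.ofLp h0) 1
      simp at e0 e1
      tauto
    have hpos := h _ hne
    rw [map_add, map_smul, map_smul] at hpos
    simp only [mink_add_left, mink_add_right, mink_smul_left, mink_smul_right] at hpos
    change 0 < a * (a * A 0 0 + b * A 1 0) + b * (a * A 0 1 + b * A 1 1) at hpos
    rw [hA, inducedMetric_comm F x 1 0, ← hA] at hpos
    linarith
  have h11 := hq 0 1 (by simp)
  -- At this vector, orthogonal to `∂₁`, the quadratic form equals `A 1 1 * det A`.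
  have hd := hq (A 1 1) (-A 0 1) (Or.inl (by simp at h11; exact h11.ne'))
  rw [Matrix.det_fin_two, hA, inducedMetric_comm F x 1 0, ← hA]
  simp at h11
  refine pos_of_mul_pos_right (a := A 1 1) ?_ h11.le
  linarith

section Chart

variable {M : Type*} [TopologicalSpace M] [ChartedSpace Plane M]
  {ψ : M → L4} {e : OpenPartialHomeomorph M Plane}

theorem contDiffAt_inChart (hψ : IsSpacelikeSurface ψ)
    (he : e ∈ IsManifold.maximalAtlas (𝓡 2) ∞ M) {y : Plane} (hy : y ∈ e.target) :
    ContDiffAt ℝ ∞ (inChart ψ e) y := by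
  have hs := (contMDiffOn_symm_of_mem_maximalAtlas he).contMDiffAt (e.open_target.mem_nhds hy)
  exact (hψ.smooth.contMDiffAt.comp y hs).contDiffAt

/-- The inverse chart has injective differential, so positivity on nonzero tangent vectors of `M`
passes to nonzero coordinate vectors. -/
theorem det_inducedMetric_inChart_pos (hψ : IsSpacelikeSurface ψ)
    (he : e ∈ IsManifold.maximalAtlas (𝓡 2) ∞ M) {y : Plane} (hy : y ∈ e.target) :
    0 < (inducedMetric (inChart ψ e) y).det := by
  have hs := contMDiffOn_symm_of_mem_maximalAtlas he
  have hm : e.MDifferentiable (𝓡 2) (𝓡 2) :=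
    ⟨(contMDiffOn_of_mem_maximalAtlas he).mdifferentiableOn (by simp),
      hs.mdifferentiableOn (by simp)⟩
  refine det_inducedMetric_pos fun v hv => ?_
  have hcomp : fderiv ℝ (inChart ψ e) y v =
      mfderiv (𝓡 2) 𝓘(ℝ, L4) ψ (e.symm y) (mfderiv (𝓡 2) (𝓡 2) e.symm y v) := by
    rw [← mfderiv_eq_fderiv]
    have := mfderiv_comp y (hψ.smooth.mdifferentiableAt (by simp))
      ((hs.contMDiffAt (e.open_target.mem_nhds hy)).mdifferentiableAt (by simp))
    exact congrArg (fun L => L v) this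
  rw [hcomp]
  refine hψ.riemannian _ _ fun h0 => hv ?_
  exact hm.symm.mfderiv_injective hy (h0.trans (map_zero _).symm)

end Chart

end LightconeSurface

end

/-! ### The theorem on the manifold -/

open LightconeSurface in
theorem corollary3p6 {M : Type*} [TopologicalSpace M] [ChartedSpace Plane M]
    [IsManifold (𝓡 2) ∞ M] (ψ : M → L4) (hψ : IsSpacelikeSurface ψ)
    (hcone : ∀ p : M, ψ p ∈ futureLightcone)
    (ψ₀ : M → ℝ) (hψ₀ : ∀ p : M, ψ₀ p = ψ p 0)
    (e : OpenPartialHomeomorph M Plane) (he : e ∈ IsManifold.maximalAtlas (𝓡 2) ∞ M)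
    (q : M) (hq : q ∈ e.source) :
    surfaceT ψ e q = timeVec + surfaceGradVec ψ ψ₀ e q ∧
    surfaceH ψ e q =
      (surfaceLaplacian ψ ψ₀ e q / (2 * ψ₀ q)
        - (1 + surfaceGradNormSq ψ ψ₀ e q) / ψ₀ q ^ 2) • ψ q
      + (1 / ψ₀ q) • surfaceT ψ e q ∧
    surfaceK ψ e q =
      (1 + surfaceGradNormSq ψ ψ₀ e q) / ψ₀ q ^ 2 - surfaceLaplacian ψ ψ₀ e q / ψ₀ q ∧
    surfaceK ψ e q = mink (surfaceH ψ e q) (surfaceH ψ e q) := by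
  obtain rfl : ψ₀ = fun p => ψ p 0 := funext hψ₀
  have hx : e q ∈ e.target := e.map_source hq
  have hU := e.open_target.eventually_mem hx
  have hqx : ψ q = inChart ψ e (e q) := by rw [inChart, e.left_inv hq]
  have hsm : ∀ᶠ y in nhds (e q), ContDiffAt ℝ ∞ (inChart ψ e) y :=
    hU.mono fun y hy => contDiffAt_inChart hψ he hy
  have hdet : ∀ᶠ y in nhds (e q), (inducedMetric (inChart ψ e) y).det ≠ 0 :=
    hU.mono fun y hy => (det_inducedMetric_inChart_pos hψ he hy).ne'
  -- No restriction to `e.target` is needed: `e.symm` is total and every value of `ψ` is null.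
  have hnull : ∀ᶠ y in nhds (e q), mink (inChart ψ e y) (inChart ψ e y) = 0 :=
    Filter.Eventually.of_forall fun y => (hcone _).1
  have hpos : 0 < inChart ψ e (e q) 0 := (hcone _).2
  have hqx' : (fun p => ψ p 0) q = inChart ψ e (e q) 0 := congrFun hqx 0
  rw [hqx', hqx]
  exact ⟨normalPart_timeVec (hsm.self_of_nhds.differentiableAt (by simp)),
    meanCurvature_eq_of_null hsm hdet.self_of_nhds hnull hpos,
    gaussCurvature_eq_of_null hsm hdet hnull hpos,
    gaussCurvature_eq_mink_meanCurvature hsm hdet hnull hpos⟩
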